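/- Let $K$ be a perfect field. For a commutative $K$-algebra $R$ let $\mathrm{Dif}_{R/K}$ be its algebra of higher differentials: let $G=R[\mathrm{d}^{(k)}r \mid k\ge 1,\ r\in R]$ be the polynomial algebra in which $\mathrm{d}^{(k)}r$ has degree $k$, put $\mathrm{d}^{(0)}r:=r$, and let $I\subseteq G$ be the homogeneous ideal generated by all $\mathrm{d}^{(k)}(r+s)-\mathrm{d}^{(k)}r-\mathrm{d}^{(k)}s$, all $\mathrm{d}^{(k)}a$ and all $\mathrm{d}^{(k)}(rs)-\sum_{i=0}^k \mathrm{d}^{(i)}r\,\mathrm{d}^{(k-i)}s$, for $k\ge 1$, $r,s\in R$ and $a\in K$; then $\mathrm{Dif}_{R/K}$ is the completion of the graded $R$-algebra $G/I$. Here the completion of a graded algebra $A=\bigoplus_{i\ge 0}A_i$ is $\varprojlim_k A/\bigoplus_{i\ge k}A_i$, and a homomorphism between two such completions is a homomorphism of completions of graded algebras if it is induced by a homomorphism of the underlying graded $R$-algebras. Equivalently, $\mathrm{Dif}_{R/K}$ with $\mathrm{d}_R(r)=\sum_{k\ge 0}\mathrm{d}^{(k)}r$ represents higher derivations of $R$ over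 $K$ into completions of graded algebras. For $t_1,\dots,t_m\in R$ write $R[[\mathrm{d}^{(i)}t_j \mid i\ge 1,\ 1\le j\le m]]$ for the completion of the polynomial algebra over $R$ in independent variables $x_{i,j}$ ($i\ge 1$, $1\le j\le m$), where $x_{i,j}$ has degree $i$. We say that $\mathrm{Dif}_{R/K}=R[[\mathrm{d}^{(i)}t_j]]$ if there is an isomorphism of completions of graded $R$-algebras from this completion to $\mathrm{Dif}_{R/K}$ that sends $x_{i,j}$ to $\mathrm{d}^{(i)}t_j$ for all $i,j$. Let $m\ge 0$. (a) If $R=K[t_1,\dots,t_m]$ is the polynomial ring in $m$ variables, then $\mathrm{Dif}_{R/K}=R[[\mathrm{d}^{(i)}t_j]]$. (b) If $t_1,\dots,t_m$ are elements of an extension field $F$ of $K$ that are algebraically independent over $K$, and $F/K(t_1,\dots,t_m)$ is a finite separable field extension, then $\mathrm{Dif}_{F/K}=F[[\mathrm{d}^{(i)}t_j]]$. (c) If $(R,\mathfrak m)$ is a regular local ring of dimension $m$ that is a localisation of a finitely generated $K$-algebra, $t_1,\dots,t_m$ generate $\mathfrak m$, and $R/\mathfrak m$ is a finite separable extension of $K$,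 then $\mathrm{Dif}_{R/K}=R[[\mathrm{d}^{(i)}t_j]]$. -/

import Mathlib

open DirectSum MvPolynomial

/-! ## Completions of graded algebras -/

namespace GradedCompletion

variable {R A B : Type*} [CommRing R] [CommRing A] [CommRing B] [Algebra R A] [Algebra R B]

/-- The ideal `I_k = ⨁_{i ≥ k} A_i` of a graded algebra `A = ⨁ A_i`: the elements whose
homogeneous components in all degrees below `k` vanish. -/
def filtration (𝒜 : ℕ → Submodule R A) [GradedAlgebra 𝒜] (k : ℕ) : Ideal A where
  carrier := {a | ∀ i < k, (decompose 𝒜 a i : A) = 0}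
  zero_mem' := by
    intro i _
    simp
  add_mem' := by
    intro a b ha hb i hi
    simp [decompose_add, ha i hi, hb i hi]
  smul_mem' := by
    intro c a ha i hi
    rw [smul_eq_mul, decompose_mul, coe_mul_apply_eq_sum_antidiagonal]
    refine Finset.sum_eq_zero fun p hp => ?_
    have hp2 : p.2 < k := lt_of_le_of_lt (Finset.HasAntidiagonal.antidiagonal.snd_le hp) hi
    rw [ha p.2 hp2, mul_zero]

theorem mem_filtration {𝒜 : ℕ → Submodule R A} [GradedAlgebra 𝒜] {k : ℕ} {a : A} :
    a ∈ filtration 𝒜 k ↔ ∀ i < k, (decompose 𝒜 a i : A) = 0 := Iff.rfl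

theorem filtration_antitone (𝒜 : ℕ → Submodule R A) [GradedAlgebra 𝒜] {k l : ℕ} (h : k ≤ l) :
    filtration 𝒜 l ≤ filtration 𝒜 k := fun _ ha i hi => ha i (lt_of_lt_of_le hi h)

end GradedCompletion

open GradedCompletion in
/-- The completion (cga) of the graded `R`-algebra `A = ⨁ A_i` with respect to the filtration by
the ideals `I_k`, i.e. the inverse limit of the rings `A / I_k`, as a subalgebra of their
product. -/
def GradedCompletion {R A : Type*} [CommRing R] [CommRing A] [Algebra R A]
    (𝒜 : ℕ → Submodule R A) [GradedAlgebra 𝒜] :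
    Subalgebra R (∀ k : ℕ, A ⧸ filtration 𝒜 k) where
  carrier := {x | ∀ (k l : ℕ) (h : k ≤ l),
    Ideal.Quotient.factor (filtration_antitone 𝒜 h) (x l) = x k}
  mul_mem' := by
    intro x y hx hy k l h
    simp [hx k l h, hy k l h]
  add_mem' := by
    intro x y hx hy k l h
    simp [hx k l h, hy k l h]
  algebraMap_mem' := by
    intro r k l h
    simp only [Pi.algebraMap_apply]
    rfl

namespace GradedCompletion

variable {R A B : Type*} [CommRing R] [CommRing A] [CommRing B] [Algebra R A] [Algebra R B]

section

variable (𝒜 : ℕ → Submodule R A) [GradedAlgebra 𝒜]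

/-- The canonical map of a graded algebra to its completion. -/
def of : A →ₐ[R] GradedCompletion 𝒜 :=
  (AlgHom.pi fun k => Ideal.Quotient.mkₐ R (filtration 𝒜 k)).codRestrict _ (by
    intro a k l h
    rfl)

/-- The projection of the completion to its `i`-th homogeneous component `A_i`. -/
noncomputable def pr (i : ℕ) (x : GradedCompletion 𝒜) : 𝒜 i :=
  decompose 𝒜 (Quotient.out (x.1 (i + 1)) : A) i

/-- The element `∑ b_i` of the completion, for a sequence `b_i ∈ A_i`. -/
def series (b : ∀ i, 𝒜 i) : GradedCompletion 𝒜 :=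
  ⟨fun k => Ideal.Quotient.mk _ (∑ i ∈ Finset.range k, (b i : A)), by
    intro k l h
    rw [Ideal.Quotient.factor_mk, Ideal.Quotient.eq, mem_filtration]
    intro i hi
    rw [← Finset.sum_range_add_sum_Ico _ h, add_sub_cancel_left, decompose_sum]
    rw [DFinsupp.finsetSum_apply, AddSubmonoidClass.coe_finsetSum]
    refine Finset.sum_eq_zero fun j hj => ?_
    rw [decompose_of_mem_ne 𝒜 (b j).2]
    have := (Finset.mem_Ico.1 hj).1
    omega⟩

variable {𝒜}

theorem pr_eq {i k : ℕ} (h : i < k) {x : GradedCompletion 𝒜} {a : A}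
    (hx : x.1 k = Ideal.Quotient.mk _ a) : pr 𝒜 i x = decompose 𝒜 a i := by
  have h1 : Ideal.Quotient.mk (filtration 𝒜 (i + 1)) (Quotient.out (x.1 (i + 1)) : A)
      = Ideal.Quotient.mk _ a := by
    have h2 := x.2 (i + 1) k h
    rw [hx, Ideal.Quotient.factor_mk] at h2
    rw [h2]
    exact Quotient.out_eq _
  rw [Ideal.Quotient.eq, mem_filtration] at h1
  have h3 := h1 i (Nat.lt_succ_self i)
  rw [decompose_sub] at h3
  apply Subtype.ext
  simpa [pr, sub_eq_zero] using h3

theorem ext_pr {x y : GradedCompletion 𝒜} (h : ∀ i, pr 𝒜 i x = pr 𝒜 i y) : x = y := by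
  apply Subtype.ext
  funext k
  obtain ⟨a, ha⟩ := Ideal.Quotient.mk_surjective (x.1 k)
  obtain ⟨b, hb⟩ := Ideal.Quotient.mk_surjective (y.1 k)
  rw [← ha, ← hb, Ideal.Quotient.eq, mem_filtration]
  intro i hi
  have := h i
  rw [pr_eq hi ha.symm, pr_eq hi hb.symm] at this
  simp [decompose_sub, this]

theorem pr_series (b : ∀ i, 𝒜 i) (i : ℕ) : pr 𝒜 i (series 𝒜 b) = b i := by
  rw [pr_eq (Nat.lt_succ_self i) (x := series 𝒜 b) rfl]
  apply Subtype.ext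
  rw [decompose_sum, DFinsupp.finsetSum_apply, AddSubmonoidClass.coe_finsetSum,
    Finset.sum_eq_single i]
  · rw [decompose_of_mem_same 𝒜 (b i).2]
  · intro j _ hj
    rw [decompose_of_mem_ne 𝒜 (b j).2 hj]
  · intro hi
    simp at hi

theorem pr_of (a : A) (i : ℕ) : pr 𝒜 i (of 𝒜 a) = decompose 𝒜 a i :=
  pr_eq (Nat.lt_succ_self i) rfl

theorem pr_add (x y : GradedCompletion 𝒜) (i : ℕ) : pr 𝒜 i (x + y) = pr 𝒜 i x + pr 𝒜 i y := by
  obtain ⟨a, ha⟩ := Ideal.Quotient.mk_surjective (x.1 (i + 1))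
  obtain ⟨b, hb⟩ := Ideal.Quotient.mk_surjective (y.1 (i + 1))
  have hab : (x + y).1 (i + 1) = Ideal.Quotient.mk _ (a + b) := by
    rw [map_add, ha, hb]
    rfl
  rw [pr_eq (Nat.lt_succ_self i) hab, pr_eq (Nat.lt_succ_self i) ha.symm,
    pr_eq (Nat.lt_succ_self i) hb.symm, decompose_add]
  rfl

theorem pr_mul (x y : GradedCompletion 𝒜) (k : ℕ) :
    (pr 𝒜 k (x * y) : A) =
      ∑ p ∈ Finset.HasAntidiagonal.antidiagonal k, (pr 𝒜 p.1 x : A) * (pr 𝒜 p.2 y : A) := by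
  obtain ⟨a, ha⟩ := Ideal.Quotient.mk_surjective (x.1 (k + 1))
  obtain ⟨b, hb⟩ := Ideal.Quotient.mk_surjective (y.1 (k + 1))
  have hab : (x * y).1 (k + 1) = Ideal.Quotient.mk _ (a * b) := by
    rw [map_mul, ha, hb]
    rfl
  rw [pr_eq (Nat.lt_succ_self k) hab, decompose_mul, coe_mul_apply_eq_sum_antidiagonal]
  refine Finset.sum_congr rfl fun p hp => ?_
  have h1 : p.1 < k + 1 := Nat.lt_succ_of_le (Finset.HasAntidiagonal.antidiagonal.fst_le hp)
  have h2 : p.2 < k + 1 := Nat.lt_succ_of_le (Finset.HasAntidiagonal.antidiagonal.snd_le hp)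
  rw [pr_eq h1 ha.symm, pr_eq h2 hb.symm]

end

section map

variable {𝒜 : ℕ → Submodule R A} [GradedAlgebra 𝒜] {ℬ : ℕ → Submodule R B} [GradedAlgebra ℬ]

theorem filtration_le_comap (f : 𝒜 →ₐᵍ[R] ℬ) (k : ℕ) :
    filtration 𝒜 k ≤ (filtration ℬ k).comap (f : A →ₐ[R] B) := by
  intro a ha i hi
  have h := map_directSumDecompose (𝒜 := 𝒜) (ℬ := ℬ) f (x := a) (i := i)
  have h2 := ha i hi
  simp only [h2, map_zero] at h
  exact h.symm

/-- The homomorphism of completions induced by a homomorphism of graded `R`-algebras. -/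
def map (f : 𝒜 →ₐᵍ[R] ℬ) : GradedCompletion 𝒜 →ₐ[R] GradedCompletion ℬ :=
  AlgHom.codRestrict
    ((AlgHom.pi fun k =>
      (Ideal.quotientMapₐ (filtration ℬ k) (f : A →ₐ[R] B) (filtration_le_comap f k)).comp
        (Pi.evalAlgHom R (fun k => A ⧸ filtration 𝒜 k) k)).comp (GradedCompletion 𝒜).val)
    (GradedCompletion ℬ) (by
      intro x k l h
      obtain ⟨a, ha⟩ := Ideal.Quotient.mk_surjective (x.1 l)
      have hk := x.2 k l h
      rw [← ha, Ideal.Quotient.factor_mk] at hk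
      change Ideal.Quotient.factor _ (Ideal.quotientMapₐ (filtration ℬ l) (f : A →ₐ[R] B)
        (filtration_le_comap f l) (x.1 l)) = Ideal.quotientMapₐ (filtration ℬ k) (f : A →ₐ[R] B)
        (filtration_le_comap f k) (x.1 k)
      rw [← ha, ← hk]
      rfl)

theorem pr_map (f : 𝒜 →ₐᵍ[R] ℬ) (x : GradedCompletion 𝒜) (i : ℕ) :
    (pr ℬ i (map f x) : B) = f (pr 𝒜 i x : A) := by
  obtain ⟨a, ha⟩ := Ideal.Quotient.mk_surjective (x.1 (i + 1))
  have h1 : (map f x).1 (i + 1) = Ideal.Quotient.mk _ (f a) := by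
    change Ideal.quotientMapₐ (filtration ℬ (i + 1)) (f : A →ₐ[R] B)
        (filtration_le_comap f (i + 1)) (x.1 (i + 1)) = _
    rw [← ha]
    rfl
  rw [pr_eq (Nat.lt_succ_self i) h1, pr_eq (Nat.lt_succ_self i) ha.symm,
    map_directSumDecompose (𝒜 := 𝒜) (ℬ := ℬ)]

/-- A homomorphism of cgas is a homomorphism that is induced by a homomorphism of the underlying
graded algebras. -/
def IsCgaHom (g : GradedCompletion 𝒜 →ₐ[R] GradedCompletion ℬ) : Prop :=
  ∃ f : 𝒜 →ₐᵍ[R] ℬ, g = map f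

end map

end GradedCompletion

/-! ## Quotients of graded algebras by homogeneous ideals -/

section Quotient

variable {R A : Type*} [CommRing R] [CommRing A] [Algebra R A]

/-- The induced grading on the quotient of a graded algebra by an ideal: the degree `i` part is
the image of `A_i`. -/
def quotientGrading (𝒜 : ℕ → Submodule R A) (I : Ideal A) : ℕ → Submodule R (A ⧸ I) :=
  fun i => (𝒜 i).map (Ideal.Quotient.mkₐ R I).toLinearMap

/-- The quotient of a graded algebra by a homogeneous ideal is a graded algebra. -/
@[reducible]
noncomputable def quotientGradedAlgebra (𝒜 : ℕ → Submodule R A) [GradedAlgebra 𝒜] (I : Ideal A)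
    (hI : I.IsHomogeneous 𝒜) : GradedAlgebra (quotientGrading 𝒜 I) :=
  let φ : ∀ i, 𝒜 i →ₗ[R] quotientGrading 𝒜 I i := fun i =>
    (Ideal.Quotient.mkₐ R I).toLinearMap.submoduleMap (𝒜 i)
  let dec : A →ₗ[R] ⨁ i, quotientGrading 𝒜 I i :=
    (DirectSum.lmap φ).comp (decomposeLinearEquiv 𝒜).toLinearMap
  have hcoe : ∀ a : A, DirectSum.coeAddMonoidHom (quotientGrading 𝒜 I) (dec a) =
      Ideal.Quotient.mk I a := by
    intro a
    induction a using DirectSum.Decomposition.inductionOn 𝒜 with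
    | zero => simp
    | @homogeneous i a =>
      have h1 : dec (a : A) = DirectSum.of (fun i => quotientGrading 𝒜 I i) i (φ i a) := by
        change DirectSum.lmap φ (decompose 𝒜 (a : A)) = _
        rw [decompose_coe]
        exact DirectSum.lmap_lof φ i a
      rw [h1, DirectSum.coeAddMonoidHom_of]
      rfl
    | add a b ha hb => rw [map_add, map_add, map_add, ha, hb]
  have hker : ∀ a ∈ I, dec a = 0 := by
    intro a ha
    apply DFinsupp.ext
    intro i
    apply Subtype.ext
    have h1 : (dec a i : A ⧸ I) = Ideal.Quotient.mk I (decompose 𝒜 a i : A) := by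
      rfl
    rw [h1]
    simpa using Ideal.Quotient.eq_zero_iff_mem.2 (hI i ha)
  have hsurj : Function.Surjective dec := by
    have h1 : Function.Surjective (DirectSum.lmap φ) := by
      rw [DirectSum.lmap_surjective]
      exact fun i => LinearMap.submoduleMap_surjective _ _
    exact h1.comp (decomposeLinearEquiv 𝒜).surjective
  have hdec : ∀ a b : A, Ideal.Quotient.mk I a = Ideal.Quotient.mk I b → dec a = dec b := by
    intro a b h
    have h1 := hker _ (Ideal.Quotient.eq.1 h)
    rwa [map_sub dec, sub_eq_zero] at h1
  { one_mem := ⟨1, SetLike.GradedOne.one_mem, map_one (Ideal.Quotient.mkₐ R I)⟩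
    mul_mem := by
      rintro i j _ _ ⟨a, ha, rfl⟩ ⟨b, hb, rfl⟩
      exact ⟨a * b, SetLike.GradedMul.mul_mem ha hb, map_mul (Ideal.Quotient.mkₐ R I) _ _⟩
    decompose' := fun x => dec (Quotient.out x : A)
    left_inv := by
      intro x
      exact (hcoe _).trans (Quotient.out_eq _)
    right_inv := by
      intro y
      obtain ⟨a, rfl⟩ := hsurj y
      apply hdec
      rw [hcoe]
      exact Quotient.out_eq _ }

end Quotient

/-! ## Polynomial algebras in variables of prescribed positive degrees -/

/-- The grading of the polynomial algebra `R[x_{k,j} | k ∈ ℕ₊, j ∈ J]` in which the variable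
`x_{k,j}` has degree `k`. -/
abbrev polyGrading (R J : Type*) [CommRing R] : ℕ → Submodule R (MvPolynomial (ℕ+ × J) R) :=
  weightedHomogeneousSubmodule R (fun p : ℕ+ × J => (p.1 : ℕ))

noncomputable instance polyGradedAlgebra (R J : Type*) [CommRing R] :
    GradedAlgebra (polyGrading R J) :=
  weightedGradedAlgebra R _

/-! ## The algebra of higher differentials -/

namespace HigherDifferentials

section

variable (K R : Type*) [CommRing K] [CommRing R] [Algebra K R]

/-- The symbol `d^{(k)} r` in the polynomial algebra `G = R[d^{(k)} r | k ∈ ℕ₊, r ∈ R]`; by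
convention `d^{(0)} r = r`. -/
noncomputable def symbol (k : ℕ) (r : R) : MvPolynomial (ℕ+ × R) R :=
  if h : 0 < k then X (⟨k, h⟩, r) else C r

/-- The additivity, constancy and Leibniz relations between the symbols `d^{(k)} r`. -/
inductive Relation : MvPolynomial (ℕ+ × R) R → Prop
  | add (k : ℕ+) (r s : R) :
      Relation (symbol R k (r + s) - symbol R k r - symbol R k s)
  | const (k : ℕ+) (a : K) :
      Relation (symbol R k (algebraMap K R a))
  | mul (k : ℕ+) (r s : R) :
      Relation (symbol R k (r * s) -
        ∑ p ∈ Finset.HasAntidiagonal.antidiagonal (k : ℕ), symbol R p.1 r * symbol R p.2 s)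

/-- The ideal of `G` generated by the relations. -/
noncomputable def relations : Ideal (MvPolynomial (ℕ+ × R) R) := Ideal.span {x | Relation K R x}

variable {R} in
theorem symbol_mem (k : ℕ) (r : R) : symbol R k r ∈ polyGrading R R k := by
  unfold symbol
  split_ifs with h
  · exact isWeightedHomogeneous_X R (fun p : ℕ+ × R => (p.1 : ℕ)) (⟨k, h⟩, r)
  · obtain rfl : k = 0 := by omega
    exact isWeightedHomogeneous_C _ r

theorem relations_isHomogeneous : (relations K R).IsHomogeneous (polyGrading R R) := by
  apply Ideal.homogeneous_span
  rintro _ (⟨k, r, s⟩ | ⟨k, a⟩ | ⟨k, r, s⟩)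
  · exact ⟨k, sub_mem (sub_mem (symbol_mem _ _) (symbol_mem _ _)) (symbol_mem _ _)⟩
  · exact ⟨k, symbol_mem _ _⟩
  · refine ⟨k, sub_mem (symbol_mem _ _) (sum_mem fun p hp => ?_)⟩
    rw [← Finset.HasAntidiagonal.mem_antidiagonal.1 hp]
    exact SetLike.GradedMul.mul_mem (symbol_mem _ _) (symbol_mem _ _)

/-- The graded algebra underlying the algebra of higher differentials. -/
noncomputable abbrev Alg : Type _ := MvPolynomial (ℕ+ × R) R ⧸ relations K R

/-- The grading in which the class of `d^{(k)} r` has degree `k`. -/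
noncomputable abbrev grading : ℕ → Submodule R (Alg K R) := quotientGrading (polyGrading R R) (relations K R)

noncomputable instance gradedAlgebra : GradedAlgebra (grading K R) :=
  quotientGradedAlgebra _ _ (relations_isHomogeneous K R)

/-- The algebra of higher differentials `Dif_{R/K}`. -/
abbrev Dif : Type _ := GradedCompletion (grading K R)

variable {R}

/-- The class of `d^{(k)} r` in the graded algebra underlying `Dif_{R/K}`. -/
noncomputable def d (k : ℕ) (r : R) : Alg K R := Ideal.Quotient.mk _ (symbol R k r)

theorem d_mem (k : ℕ) (r : R) : d K k r ∈ grading K R k := ⟨_, symbol_mem k r, rfl⟩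

theorem d_zero (r : R) : d K 0 r = algebraMap R (Alg K R) r := by
  simp only [d, symbol, lt_irrefl, dite_false]
  rfl

theorem d_pos (k : ℕ+) (r : R) : d K k r = Ideal.Quotient.mk _ (X (k, r)) := by
  simp only [d, symbol, k.pos, dite_true]
  rfl

theorem d_eq_zero_of_relation {x : MvPolynomial (ℕ+ × R) R} (h : Relation K R x) :
    Ideal.Quotient.mk (relations K R) x = 0 :=
  Ideal.Quotient.eq_zero_iff_mem.2 (Ideal.subset_span h)

theorem d_add (k : ℕ) (r s : R) : d K k (r + s) = d K k r + d K k s := by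
  rcases Nat.eq_zero_or_pos k with rfl | hk
  · simp only [d_zero, map_add]
  · have h := d_eq_zero_of_relation K (Relation.add ⟨k, hk⟩ r s)
    simp only [map_sub, PNat.mk_coe, sub_sub, sub_eq_zero] at h
    exact h

theorem d_mul (k : ℕ) (r s : R) :
    d K k (r * s) = ∑ p ∈ Finset.HasAntidiagonal.antidiagonal k, d K p.1 r * d K p.2 s := by
  rcases Nat.eq_zero_or_pos k with rfl | hk
  · simp [d_zero]
  · have h := d_eq_zero_of_relation K (Relation.mul ⟨k, hk⟩ r s)
    simp only [map_sub, PNat.mk_coe, sub_eq_zero, map_sum, map_mul] at h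
    exact h

theorem d_algebraMap {k : ℕ} (hk : 0 < k) (a : K) : d K k (algebraMap K R a) = 0 :=
  d_eq_zero_of_relation K (Relation.const ⟨k, hk⟩ a)

theorem pr_algebraMap {A : Type*} [CommRing A] [Algebra R A] (𝒜 : ℕ → Submodule R A)
    [GradedAlgebra 𝒜] (r : R) (i : ℕ) :
    (GradedCompletion.pr 𝒜 i (algebraMap R (GradedCompletion 𝒜) r) : A) =
      if i = 0 then algebraMap R A r else 0 := by
  rw [← (GradedCompletion.of 𝒜).commutes, GradedCompletion.pr_of]
  have h0 : algebraMap R A r ∈ 𝒜 0 := SetLike.algebraMap_mem_graded 𝒜 r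
  split_ifs with h
  · subst h
    exact decompose_of_mem_same 𝒜 h0
  · exact decompose_of_mem_ne 𝒜 h0 (Ne.symm h)

/-- The universal higher derivation `d_R : R → Dif_{R/K}`, `r ↦ ∑ d^{(k)} r`. -/
noncomputable def universalDerivation : R →ₐ[K] Dif K R :=
  have hpr : ∀ (r : R) (k : ℕ),
      (GradedCompletion.pr (grading K R) k
        (GradedCompletion.series (grading K R) fun k => ⟨d K k r, d_mem K k r⟩) : Alg K R)
      = d K k r := fun r k => by rw [GradedCompletion.pr_series]
  have halg : ∀ a : K, GradedCompletion.series (grading K R)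
      (fun k => ⟨d K k (algebraMap K R a), d_mem K k _⟩) =
      algebraMap R (Dif K R) (algebraMap K R a) := fun a => by
    refine GradedCompletion.ext_pr fun k => Subtype.ext ?_
    rw [hpr, pr_algebraMap]
    split_ifs with h
    · rw [h, d_zero]
    · exact d_algebraMap K (Nat.pos_of_ne_zero h) a
  { toFun := fun r => GradedCompletion.series (grading K R) fun k => ⟨d K k r, d_mem K k r⟩
    map_one' := by
      have := halg 1
      simpa only [map_one] using this
    map_zero' := by
      have := halg 0
      simpa only [map_zero] using this
    map_add' := fun r s => by
      refine GradedCompletion.ext_pr fun k => Subtype.ext ?_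
      rw [GradedCompletion.pr_add, Submodule.coe_add, hpr, hpr, hpr, d_add]
    map_mul' := fun r s => by
      refine GradedCompletion.ext_pr fun k => Subtype.ext ?_
      rw [GradedCompletion.pr_mul, hpr, d_mul]
      simp only [hpr]
    commutes' := fun a => by
      rw [halg a]
      rfl }

theorem pr_universalDerivation (k : ℕ) (r : R) :
    (GradedCompletion.pr (grading K R) k (universalDerivation K r) : Alg K R) = d K k r := by
  change (GradedCompletion.pr (grading K R) k
        (GradedCompletion.series (grading K R) fun k => ⟨d K k r, d_mem K k r⟩) : Alg K R)
      = d K k r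
  rw [GradedCompletion.pr_series]

/-- A higher derivation of `R` over `K` to the completion `B` of a graded `R`-algebra: a
homomorphism of `K`-algebras `ψ : R → B` whose composite with the augmentation `B → B_0` is the
structure map `R → B_0`. -/
structure IsHigherDerivation {B : Type*} [CommRing B] [Algebra R B] [Algebra K B]
    [IsScalarTower K R B] (ℬ : ℕ → Submodule R B) [GradedAlgebra ℬ]
    (ψ : R →ₐ[K] GradedCompletion ℬ) : Prop where
  augmentation : ∀ r : R, (GradedCompletion.pr ℬ 0 (ψ r) : B) = algebraMap R B r

theorem isHigherDerivation_universalDerivation :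
    IsHigherDerivation K (grading K R) (universalDerivation K (R := R)) :=
  ⟨fun r => by rw [pr_universalDerivation, d_zero]⟩

theorem isHigherDerivation_pr_symbol {B : Type*} [CommRing B] [Algebra R B] [Algebra K B]
    [IsScalarTower K R B] (ℬ : ℕ → Submodule R B) [GradedAlgebra ℬ]
    (ψ : R →ₐ[K] GradedCompletion ℬ) (hψ : IsHigherDerivation K ℬ ψ) (k : ℕ) (r : R) :
    aeval (fun p : ℕ+ × R => (GradedCompletion.pr ℬ p.1 (ψ p.2) : B)) (symbol R k r) =
      GradedCompletion.pr ℬ k (ψ r) := by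
  unfold symbol
  split_ifs with h
  · simp
  · obtain rfl : k = 0 := by omega
    rw [hψ.augmentation, algHom_C]

/-- The universal property that characterises `Dif_{R/K}`: it represents higher derivations. -/
theorem existsUnique_cgaHom {B : Type*} [CommRing B] [Algebra R B] [Algebra K B]
    [IsScalarTower K R B] (ℬ : ℕ → Submodule R B) [GradedAlgebra ℬ]
    (ψ : R →ₐ[K] GradedCompletion ℬ) (hψ : IsHigherDerivation K ℬ ψ) :
    ∃! g : Dif K R →ₐ[R] GradedCompletion ℬ,
      GradedCompletion.IsCgaHom g ∧ ∀ r, g (universalDerivation K r) = ψ r := by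
  set e : MvPolynomial (ℕ+ × R) R →ₐ[R] B :=
    aeval (fun p : ℕ+ × R => (GradedCompletion.pr ℬ p.1 (ψ p.2) : B)) with he
  have hsym := isHigherDerivation_pr_symbol K ℬ ψ hψ
  have hrel : ∀ x ∈ relations K R, e x = 0 := by
    intro x hx
    have : relations K R ≤ RingHom.ker e := by
      refine Ideal.span_le.2 ?_
      rintro _ (⟨k, r, s⟩ | ⟨k, a⟩ | ⟨k, r, s⟩)
      · simp only [SetLike.mem_coe, RingHom.mem_ker, map_sub, he, hsym, map_add,
          GradedCompletion.pr_add, Submodule.coe_add]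
        ring
      · have h0 := pr_algebraMap ℬ (algebraMap K R a) k
        rw [if_neg k.ne_zero] at h0
        simp only [SetLike.mem_coe, RingHom.mem_ker, he, hsym, AlgHom.commutes]
        rw [IsScalarTower.algebraMap_apply K R (GradedCompletion ℬ)]
        exact h0
      · simp only [SetLike.mem_coe, RingHom.mem_ker, map_sub, map_sum, map_mul, he, hsym,
          GradedCompletion.pr_mul, sub_self]
    exact this hx
  let f₀ : Alg K R →ₐ[R] B := Ideal.Quotient.liftₐ _ e hrel
  have hf₀ : ∀ x, f₀ (Ideal.Quotient.mk _ x) = e x := fun x => rfl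
  have hgr : ∀ {i : ℕ} {x : Alg K R}, x ∈ grading K R i → f₀ x ∈ ℬ i := by
    rintro i _ ⟨x, hx, rfl⟩
    change e x ∈ ℬ i
    rw [x.as_sum, map_sum]
    refine sum_mem fun c hc => ?_
    have hw := hx (mem_support_iff.1 hc)
    rw [he, aeval_monomial, ← Algebra.smul_def]
    refine Submodule.smul_mem _ _ ?_
    rw [← hw, Finsupp.weight_apply]
    refine SetLike.prod_mem_graded _ _ _ fun p _ => ?_
    exact SetLike.pow_mem_graded _ (Subtype.mem _)
  let f : grading K R →ₐᵍ[R] ℬ := { f₀ with map_mem := hgr }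
  have hf : ∀ x, f x = f₀ x := fun _ => rfl
  refine ⟨GradedCompletion.map f, ⟨⟨f, rfl⟩, fun r => ?_⟩, ?_⟩
  · refine GradedCompletion.ext_pr fun k => Subtype.ext ?_
    rw [GradedCompletion.pr_map, pr_universalDerivation, hf, d, hf₀, he, hsym]
  · rintro _ ⟨⟨f', rfl⟩, h'⟩
    have : f' = f := by
      apply GradedAlgHom.coe_toAlgHom_injective
      apply Ideal.Quotient.algHom_ext
      apply MvPolynomial.algHom_ext
      rintro ⟨k, r⟩
      change f' (Ideal.Quotient.mk _ (X (k, r))) = f₀ (Ideal.Quotient.mk _ (X (k, r)))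
      rw [← d_pos, ← pr_universalDerivation, ← GradedCompletion.pr_map, h',
        pr_universalDerivation, d, hf₀, he, hsym]
    rw [this]

/-- `Dif_{R/K}` is the completion `R[[d^{(i)} t_j | i ∈ ℕ₊, j]]` of the polynomial algebra in the
`d^{(i)} t_j`: the polynomial algebra `R[x_{i,j}]`, with `x_{i,j}` of degree `i`, has a completion
that is isomorphic to `Dif_{R/K}` as a cga, by an isomorphism with `x_{i,j} ↦ d^{(i)} t_j`. -/
def IsCompletedPolynomialAlgebra {m : ℕ} (t : Fin m → R) : Prop :=
  ∃ e : GradedCompletion (polyGrading R (Fin m)) ≃ₐ[R] Dif K R,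
    GradedCompletion.IsCgaHom e.toAlgHom ∧
    GradedCompletion.IsCgaHom e.symm.toAlgHom ∧
    ∀ (i : ℕ+) (j : Fin m),
      e (GradedCompletion.of _ (X (i, j))) = GradedCompletion.of _ (d K i (t j))

end

end HigherDifferentials

/-! All three cases follow from one criterion: if `R` is formally étale over `P = K[X_1, …, X_m]`,
with `X_j ↦ t_j`, then `Dif_{R/K}` is the completed polynomial algebra in the `d^{(i)} t_j`. A
higher derivation is a ring homomorphism into a completion that lifts the structure map modulo
`I_1`. Each truncation `A/I_k → A/I_1` with `k ≥ 1` has nilpotent kernel, so étaleness extends a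
higher derivation from `P` to `R` in exactly one way (`existsUnique_higherDerivation`). Existence,
applied to the generic deformation `X_j ↦ t_j + x_{1,j} + x_{2,j} + ⋯`, and the universal property
of `Dif` give a graded map `d^{(k)} t_j ↦ x_{k,j}`. Uniqueness shows that it is inverse to `x_{k,j}
↦ d^{(k)} t_j`.

It remains to find étale coordinates. A polynomial ring is étale over itself. In the field case, `P
≅ K[t] → K(t) → F` is an isomorphism followed by a localisation and a separable algebraic extension.
In the local case, `R` is unramified over `P`, because its residue field is and the `t_j` generate
`𝔪`. Hence `R` is a quotient of a local étale `P`-algebra `E`, whose maximal ideal is again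
generated by the `m` coordinates. As `dim R = m`, the ring `E` is a domain and a nonzero kernel
would lower the dimension, so `E = R`. -/

/-! ### Unique lifting along nilpotent thickenings -/

namespace Algebra.FormallyEtale

/-- Formally étale algebras have unique lifts along surjections with nilpotent kernel. -/
theorem existsUnique_ringHom_lift {P R B C : Type*} [CommRing P] [CommRing R] [CommRing B]
    [CommRing C] [Algebra P R] [Algebra.FormallyEtale P R] (π : B →+* C)
    (hπ : Function.Surjective π) (hker : IsNilpotent (RingHom.ker π)) (u : P →+* B) (v : R →+* C)
    (h : π.comp u = v.comp (algebraMap P R)) :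
    ∃! w : R →+* B, w.comp (algebraMap P R) = u ∧ π.comp w = v := by
  algebraize [u, π.comp u]
  let π' : B →ₐ[P] C := { π with commutes' := fun p => rfl }
  let v' : R →ₐ[P] C := { v with commutes' := fun p => (RingHom.congr_fun h p).symm }
  refine ⟨(Algebra.FormallySmooth.liftOfSurjective v' π' hπ hker : R →ₐ[P] B), ⟨?_, ?_⟩, ?_⟩
  · exact AlgHom.comp_algebraMap _
  · ext x
    exact Algebra.FormallySmooth.liftOfSurjective_apply v' π' hπ hker x
  · rintro w ⟨hw, hw'⟩
    let w' : R →ₐ[P] B := { w with commutes' := RingHom.congr_fun hw }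
    have : w' = Algebra.FormallySmooth.liftOfSurjective v' π' hπ hker := by
      refine Algebra.FormallyUnramified.ext' π hker _ _ fun x => ?_
      rw [show π (w' x) = v x from RingHom.congr_fun hw' x]
      exact (Algebra.FormallySmooth.liftOfSurjective_apply v' π' hπ hker x).symm
    rw [← this]
    rfl

end Algebra.FormallyEtale

/-! ### Truncations of a completion and extension of homomorphisms into it -/

namespace GradedCompletion

variable {R A : Type*} [CommRing R] [CommRing A] [Algebra R A]
  (𝒜 : ℕ → Submodule R A) [GradedAlgebra 𝒜]

theorem mul_mem_filtration {i j : ℕ} {a b : A} (ha : a ∈ filtration 𝒜 i)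
    (hb : b ∈ filtration 𝒜 j) : a * b ∈ filtration 𝒜 (i + j) := by
  intro n hn
  rw [decompose_mul, coe_mul_apply_eq_sum_antidiagonal]
  refine Finset.sum_eq_zero fun p hp => ?_
  have hp' := Finset.HasAntidiagonal.mem_antidiagonal.1 hp
  by_cases h : p.1 < i
  · rw [ha _ h, zero_mul]
  · rw [hb _ (by omega), mul_zero]

theorem filtration_zero : filtration 𝒜 0 = ⊤ :=
  (Ideal.eq_top_iff_one _).2 fun _ hi => absurd hi (Nat.not_lt_zero _)

theorem filtration_one_pow_le (k : ℕ) : filtration 𝒜 1 ^ k ≤ filtration 𝒜 k := by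
  induction k with
  | zero => rw [filtration_zero]; exact le_top
  | succ k ih =>
    rw [pow_succ, Ideal.mul_le]
    exact fun a ha b hb => mul_mem_filtration 𝒜 (ih ha) hb

/-- The kernel is `I_k / I_l`, and `I_k ^ l ≤ I_1 ^ l ≤ I_l`. This is what lets étaleness act on
truncations. -/
theorem isNilpotent_ker_factor {k l : ℕ} (hk : 1 ≤ k) (h : k ≤ l) :
    IsNilpotent (RingHom.ker (Ideal.Quotient.factor (filtration_antitone 𝒜 h))) := by
  refine ⟨l, ?_⟩
  rw [Ideal.Quotient.factor_ker, ← Ideal.map_pow, Ideal.zero_eq_bot, Ideal.map_eq_bot_iff_le_ker,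
    Ideal.mk_ker]
  exact (Ideal.pow_right_mono (filtration_antitone 𝒜 hk) l).trans (filtration_one_pow_le 𝒜 l)

/-- The projection of the completion to `A / I_k`. -/
def proj (k : ℕ) : GradedCompletion 𝒜 →+* A ⧸ filtration 𝒜 k :=
  (Pi.evalRingHom (fun k => A ⧸ filtration 𝒜 k) k).comp
    ((GradedCompletion 𝒜).val : GradedCompletion 𝒜 →+* _)

theorem proj_apply (k : ℕ) (x : GradedCompletion 𝒜) : proj 𝒜 k x = x.1 k := rfl

theorem factor_comp_proj {k l : ℕ} (h : k ≤ l) :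
    (Ideal.Quotient.factor (filtration_antitone 𝒜 h)).comp (proj 𝒜 l) = proj 𝒜 k :=
  RingHom.ext fun x => x.2 k l h

/-- A compatible family of ring homomorphisms to the truncations lifts to the completion. -/
def liftRingHom {S : Type*} [CommRing S] (g : ∀ k, S →+* A ⧸ filtration 𝒜 k)
    (hg : ∀ k l (h : k ≤ l), (Ideal.Quotient.factor (filtration_antitone 𝒜 h)).comp (g l) = g k) :
    S →+* GradedCompletion 𝒜 :=
  (RingHom.pi g).codRestrict (GradedCompletion 𝒜).toSubring
    fun s k l h => RingHom.congr_fun (hg k l h) s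

theorem proj_liftRingHom {S : Type*} [CommRing S] (g : ∀ k, S →+* A ⧸ filtration 𝒜 k)
    (hg : ∀ k l (h : k ≤ l), (Ideal.Quotient.factor (filtration_antitone 𝒜 h)).comp (g l) = g k)
    (k : ℕ) : (proj 𝒜 k).comp (liftRingHom 𝒜 g hg) = g k := rfl

variable {𝒜} in
theorem proj_one_eq_iff {x : GradedCompletion 𝒜} {a : A} :
    proj 𝒜 1 x = Ideal.Quotient.mk _ a ↔ (pr 𝒜 0 x : A) = decompose 𝒜 a 0 := by
  obtain ⟨b, hb⟩ := Ideal.Quotient.mk_surjective (x.1 1)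
  rw [pr_eq Nat.zero_lt_one hb.symm, proj_apply, ← hb, Ideal.Quotient.eq, mem_filtration]
  simp [decompose_sub, sub_eq_zero]

-- Translates the augmentation condition of a higher derivation into a lifting condition along a
-- ring homomorphism.
variable {𝒜} in
theorem proj_one_eq_algebraMap_iff {x : GradedCompletion 𝒜} {r : R} :
    proj 𝒜 1 x = Ideal.Quotient.mk _ (algebraMap R A r) ↔
      (pr 𝒜 0 x : A) = algebraMap R A r := by
  rw [proj_one_eq_iff, decompose_of_mem_same 𝒜 (SetLike.algebraMap_mem_graded 𝒜 r)]

/-- Over a formally étale algebra, a homomorphism to a completion extends uniquely. -/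
theorem existsUnique_ringHom_extension {P S : Type*} [CommRing P] [CommRing S] [Algebra P S]
    [Algebra.FormallyEtale P S] (u : P →+* GradedCompletion 𝒜) (v : S →+* A ⧸ filtration 𝒜 1)
    (h : (proj 𝒜 1).comp u = v.comp (algebraMap P S)) :
    ∃! w : S →+* GradedCompletion 𝒜, w.comp (algebraMap P S) = u ∧ (proj 𝒜 1).comp w = v := by
  -- The index is shifted to `k + 1` because `A / I_0 = 0` does not map to `A / I_1`; the family is
  -- pushed down to `A / I_k` afterwards.
  have key := fun k : ℕ => Algebra.FormallyEtale.existsUnique_ringHom_lift (P := P) (R := S)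
    (Ideal.Quotient.factor (filtration_antitone 𝒜 (Nat.le_add_left 1 k)))
    (Ideal.Quotient.factor_surjective _) (isNilpotent_ker_factor 𝒜 le_rfl (Nat.le_add_left 1 k))
    ((proj 𝒜 (k + 1)).comp u) v (by
      rw [← RingHom.comp_assoc, factor_comp_proj 𝒜 (Nat.le_add_left 1 k), h])
  choose g hg hg' using key
  -- Truncating the lift at level `l` solves the lifting problem at level `k`, so uniqueness there
  -- gives compatibility.
  have hcompat : ∀ k l (h : k ≤ l), (Ideal.Quotient.factor (filtration_antitone 𝒜
      (Nat.succ_le_succ h))).comp (g l) = g k := by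
    intro k l h
    refine hg' k _ ⟨?_, ?_⟩
    · rw [RingHom.comp_assoc, (hg l).1, ← RingHom.comp_assoc,
        factor_comp_proj 𝒜 (Nat.succ_le_succ h)]
    · rw [← (hg l).2, ← RingHom.comp_assoc, Ideal.Quotient.factor_comp]
  refine ⟨liftRingHom 𝒜 (fun k => (Ideal.Quotient.factor (filtration_antitone 𝒜
      (Nat.le_succ k))).comp (g k)) ?_, ⟨?_, ?_⟩, ?_⟩
  · intro k l h
    rw [← hcompat k l h, ← RingHom.comp_assoc, ← RingHom.comp_assoc, Ideal.Quotient.factor_comp,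
      Ideal.Quotient.factor_comp]
  · refine RingHom.ext fun p => Subtype.ext (funext fun k => ?_)
    change Ideal.Quotient.factor (filtration_antitone 𝒜 (Nat.le_succ k))
      (((g k).comp (algebraMap P S)) p) = _
    rw [(hg k).1]
    exact (u p).2 k (k + 1) (Nat.le_succ k)
  · rw [proj_liftRingHom]
    exact (hg 1).2
  · rintro w ⟨hw, hw'⟩
    refine RingHom.ext fun s => Subtype.ext (funext fun k => ?_)
    have := hg' k ((proj 𝒜 (k + 1)).comp w) ⟨by rw [RingHom.comp_assoc, hw], by
      rw [← RingHom.comp_assoc, factor_comp_proj 𝒜 (Nat.le_add_left 1 k), hw']⟩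
    change _ = Ideal.Quotient.factor (filtration_antitone 𝒜 (Nat.le_succ k)) (g k s)
    rw [← this]
    exact ((w s).2 k (k + 1) (Nat.le_succ k)).symm

section map

variable {A B C : Type*} [CommRing A] [CommRing B] [CommRing C] [Algebra R A] [Algebra R B]
  [Algebra R C] {𝒜 : ℕ → Submodule R A} [GradedAlgebra 𝒜] {ℬ : ℕ → Submodule R B}
  [GradedAlgebra ℬ]

theorem map_of (f : 𝒜 →ₐᵍ[R] ℬ) (a : A) : map f (of 𝒜 a) = of ℬ (f a) := rfl

theorem map_comp_map_eq_id (f : 𝒜 →ₐᵍ[R] ℬ) (g : ℬ →ₐᵍ[R] 𝒜) (h : ∀ a, g (f a) = a) :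
    (map g).comp (map f) = AlgHom.id R (GradedCompletion 𝒜) := by
  ext1 x
  refine ext_pr fun i => Subtype.ext ?_
  rw [AlgHom.comp_apply, pr_map, pr_map, h, AlgHom.id_apply]

end map

end GradedCompletion

/-! ### Higher derivations in étale coordinates -/

namespace HigherDifferentials

open GradedCompletion

variable {K R : Type*} [CommRing K] [CommRing R] [Algebra K R]
  {B : Type*} [CommRing B] [Algebra R B]
  (ℬ : ℕ → Submodule R B) [GradedAlgebra ℬ]

section

variable {P : Type*} [CommRing P] [Algebra K P] [Algebra P R] [IsScalarTower K P R] [Algebra K B]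
  [IsScalarTower K R B]

/-- Higher derivations extend uniquely along formally étale homomorphisms. -/
theorem existsUnique_higherDerivation [Algebra.FormallyEtale P R]
    (θ : P →ₐ[K] GradedCompletion ℬ)
    (hθ : ∀ p, (pr ℬ 0 (θ p) : B) = algebraMap R B (algebraMap P R p)) :
    ∃! ψ : R →ₐ[K] GradedCompletion ℬ,
      IsHigherDerivation K ℬ ψ ∧ ∀ p, ψ (algebraMap P R p) = θ p := by
  obtain ⟨w, ⟨hw, hw'⟩, hw''⟩ := existsUnique_ringHom_extension ℬ (P := P) (S := R)
    (θ : P →+* GradedCompletion ℬ) ((Ideal.Quotient.mk _).comp (algebraMap R B)) (by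
      ext p
      exact proj_one_eq_algebraMap_iff.2 (hθ p))
  refine ⟨{ w with
    commutes' := fun a => ?_ }, ⟨⟨fun r => ?_⟩, fun p => ?_⟩, ?_⟩
  · change w (algebraMap K R a) = _
    rw [IsScalarTower.algebraMap_apply K P R]
    exact (RingHom.congr_fun hw (algebraMap K P a)).trans (θ.commutes a)
  · exact proj_one_eq_algebraMap_iff.1 (RingHom.congr_fun hw' r)
  · exact RingHom.congr_fun hw p
  · rintro ψ ⟨hψ, hψ'⟩
    have := hw'' (ψ : R →+* _) ⟨RingHom.ext hψ', RingHom.ext fun r =>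
      proj_one_eq_algebraMap_iff.2 (hψ.augmentation r)⟩
    exact AlgHom.ext (RingHom.congr_fun this)

theorem higherDerivation_ext [Algebra.FormallyEtale P R] {ψ φ : R →ₐ[K] GradedCompletion ℬ}
    (hψ : IsHigherDerivation K ℬ ψ) (hφ : IsHigherDerivation K ℬ φ)
    (h : ∀ p : P, ψ (algebraMap P R p) = φ (algebraMap P R p)) : ψ = φ :=
  (existsUnique_higherDerivation ℬ (φ.comp (IsScalarTower.toAlgHom K P R))
    (fun _ => hφ.augmentation _)).unique ⟨hψ, h⟩ ⟨hφ, fun _ => rfl⟩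

end

theorem algHom_ext_d {f g : Alg K R →ₐ[R] B} (h : ∀ (k : ℕ+) r, f (d K k r) = g (d K k r)) :
    f = g := by
  apply Ideal.Quotient.algHom_ext
  apply MvPolynomial.algHom_ext
  rintro ⟨k, r⟩
  have := h k r
  rwa [d_pos] at this

theorem aeval_mem {J : Type*} (b : ℕ+ × J → B) (hb : ∀ p, b p ∈ ℬ p.1) {i : ℕ}
    {x : MvPolynomial (ℕ+ × J) R} (hx : x ∈ polyGrading R J i) : aeval b x ∈ ℬ i := by
  rw [x.as_sum, map_sum]
  refine sum_mem fun c hc => ?_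
  have hw := hx (mem_support_iff.1 hc)
  rw [aeval_monomial, ← Algebra.smul_def]
  refine Submodule.smul_mem _ _ ?_
  rw [← hw, Finsupp.weight_apply]
  refine SetLike.prod_mem_graded _ _ _ fun p _ => ?_
  exact SetLike.pow_mem_graded _ (hb p)

/-- The graded homomorphism on a polynomial algebra that sends the variables to given homogeneous
elements. -/
noncomputable def gradedAeval {J : Type*} (b : ℕ+ × J → B) (hb : ∀ p, b p ∈ ℬ p.1) :
    polyGrading R J →ₐᵍ[R] ℬ :=
  { aeval b with map_mem := fun {_ _} hx => aeval_mem ℬ b hb hx }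

theorem gradedAeval_X {J : Type*} (b : ℕ+ × J → B) (hb : ∀ p, b p ∈ ℬ p.1) (p : ℕ+ × J) :
    gradedAeval ℬ b hb (X p) = b p := aeval_X b p

variable (R) in
/-- The homogeneous components `t, x_1, x_2, …` of the generic deformation of `t`. -/
noncomputable def genericComponent {J : Type*} (j : J) (t : R) (k : ℕ) : polyGrading R J k :=
  if h : 0 < k then ⟨X (⟨k, h⟩, j), isWeightedHomogeneous_X R _ (⟨⟨k, h⟩, j⟩ : ℕ+ × J)⟩
  else ⟨C t, by
    obtain rfl : k = 0 := by omega
    exact isWeightedHomogeneous_C _ t⟩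

section GenericDeformation

variable {J : Type*} [Algebra (MvPolynomial J K) R]

variable (K R J) in
/-- The homomorphism `t ↦ t + x_1 + x_2 + ⋯` from the polynomial ring in variables `t`. -/
noncomputable def genericDeformation :
    MvPolynomial J K →ₐ[K] GradedCompletion (polyGrading R J) :=
  aeval fun j => series _ (genericComponent R j (algebraMap (MvPolynomial J K) R (X j)))

theorem pr_genericDeformation_X (j : J) (k : ℕ) :
    pr _ k (genericDeformation K R J (X j)) =
      genericComponent R j (algebraMap (MvPolynomial J K) R (X j)) k := by
  rw [genericDeformation, aeval_X, pr_series]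

theorem pr_genericDeformation_X_pos (j : J) (k : ℕ+) :
    (pr _ k (genericDeformation K R J (X j)) : MvPolynomial (ℕ+ × J) R) = X (k, j) := by
  rw [pr_genericDeformation_X]
  simp only [genericComponent, k.pos, dite_true]
  rfl

/-- All `x_{k,j}` vanish modulo `I_1`, so the deformation lifts the structure map. Working with the
ring homomorphism `proj 1` instead of `pr 0` allows induction on `p`. -/
theorem proj_one_genericDeformation [IsScalarTower K (MvPolynomial J K) R] (p : MvPolynomial J K) :
    proj (polyGrading R J) 1 (genericDeformation K R J p) =
      Ideal.Quotient.mk _ (algebraMap R _ (algebraMap _ R p)) := by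
  induction p using MvPolynomial.induction_on with
  | C a =>
    rw [proj_one_eq_algebraMap_iff, ← MvPolynomial.algebraMap_eq,
      (genericDeformation K R J).commutes, ← IsScalarTower.algebraMap_apply K (MvPolynomial J K) R,
      IsScalarTower.algebraMap_apply K R (GradedCompletion (polyGrading R J)), pr_algebraMap,
      if_pos rfl]
  | add p q hp hq => simp only [map_add, hp, hq]
  | mul_X p j hp =>
    have : proj (polyGrading R J) 1 (genericDeformation K R J (X j)) =
        Ideal.Quotient.mk _ (algebraMap R _ (algebraMap (MvPolynomial J K) R (X j))) := by
      rw [proj_one_eq_algebraMap_iff, pr_genericDeformation_X]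
      simp only [genericComponent, lt_irrefl, dite_false, MvPolynomial.algebraMap_eq]
    rw [map_mul, map_mul, hp, this, map_mul, map_mul, map_mul]

-- The generic deformation extends to a higher derivation of `R`, and the universal property turns
-- this into a graded homomorphism; its values are read off from the components at `X j`.
variable (K R J) in
theorem exists_gradedAlgHom_d_eq_X [IsScalarTower K (MvPolynomial J K) R]
    [Algebra.FormallyEtale (MvPolynomial J K) R] :
    ∃ f : grading K R →ₐᵍ[R] polyGrading R J,
      ∀ (k : ℕ+) j, f (d K k (algebraMap (MvPolynomial J K) R (X j))) = X (k, j) := by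
  obtain ⟨ψ, ⟨hψ, hψθ⟩, -⟩ := existsUnique_higherDerivation _ (genericDeformation K R J)
    fun p => proj_one_eq_algebraMap_iff.1 (proj_one_genericDeformation p)
  obtain ⟨_, ⟨⟨f, rfl⟩, hf⟩, -⟩ := existsUnique_cgaHom K _ ψ hψ
  refine ⟨f, fun k j => ?_⟩
  rw [← pr_universalDerivation, ← pr_map, hf, hψθ, pr_genericDeformation_X_pos]

/-- A graded endomorphism that fixes the differentials of generators of `P` is the identity,
if `R` is formally étale over `P`. -/
theorem gradedAlgHom_eq_id {P : Type*} [CommRing P] [Algebra K P] [Algebra P R]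
    [IsScalarTower K P R] [Algebra.FormallyEtale P R] (f : grading K R →ₐᵍ[R] ℬ)
    (g : ℬ →ₐᵍ[R] grading K R) {s : Set P} (hs : Algebra.adjoin K s = ⊤)
    (h : ∀ p ∈ s, ∀ k : ℕ+, g (f (d K k (algebraMap P R p))) = d K k (algebraMap P R p))
    (x : Alg K R) : g (f x) = x := by
  let u := universalDerivation K (R := R)
  -- An endomorphism of `Dif` is determined by its composite with the universal derivation, so it
  -- suffices to compare `u'` with `u`; by étaleness this may be checked on generators of `P`.
  let u' : R →ₐ[K] Dif K R := (((map g).comp (map f)).restrictScalars K).comp u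
  have hpr : ∀ k r, (pr _ k (u' r) : Alg K R) = g (f (d K k r)) := by
    intro k r
    change (pr _ k (map g (map f (u r))) : Alg K R) = _
    rw [pr_map, pr_map, pr_universalDerivation]
  have h0 : ∀ r, g (f (d K 0 r)) = d K 0 r := by
    intro r
    rw [d_zero]
    exact (g.toAlgHom.comp f.toAlgHom).commutes r
  have hu : u' = u := by
    refine higherDerivation_ext (P := P) _ ⟨fun r => ?_⟩
      (isHigherDerivation_universalDerivation K) ?_
    · rw [hpr, h0, d_zero]
    · refine AlgHom.congr_fun (φ₁ := u'.comp (IsScalarTower.toAlgHom K P R))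
        (φ₂ := u.comp (IsScalarTower.toAlgHom K P R)) (AlgHom.ext_of_adjoin_eq_top hs ?_)
      intro p hp
      refine ext_pr fun k => Subtype.ext ?_
      change (pr _ k (u' (algebraMap P R p)) : Alg K R) = pr _ k (u (algebraMap P R p))
      rw [hpr, pr_universalDerivation]
      rcases Nat.eq_zero_or_pos k with rfl | hk
      · exact h0 _
      · exact h p hp ⟨k, hk⟩
  have hid : g.toAlgHom.comp f.toAlgHom = AlgHom.id R _ := by
    refine algHom_ext_d fun k r => ?_
    change g (f (d K k r)) = d K k r
    rw [← hpr, hu, pr_universalDerivation]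
  exact AlgHom.congr_fun hid x

end GenericDeformation

-- The criterion behind all three cases. One composite is the identity because it fixes the
-- variables, the other by `gradedAlgHom_eq_id`.
variable (K) in
theorem isCompletedPolynomialAlgebra_of_formallyEtale {m : ℕ} [Algebra (MvPolynomial (Fin m) K) R]
    [IsScalarTower K (MvPolynomial (Fin m) K) R]
    [Algebra.FormallyEtale (MvPolynomial (Fin m) K) R] :
    IsCompletedPolynomialAlgebra K
      (fun j : Fin m => algebraMap (MvPolynomial (Fin m) K) R (X j)) := by
  obtain ⟨f, hf⟩ := exists_gradedAlgHom_d_eq_X K R (Fin m)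
  let g : polyGrading R (Fin m) →ₐᵍ[R] grading K R :=
    gradedAeval _ (fun p => d K p.1 (algebraMap (MvPolynomial (Fin m) K) R (X p.2)))
      fun p => d_mem K _ _
  have hg : ∀ p : ℕ+ × Fin m,
      g (X p) = d K p.1 (algebraMap (MvPolynomial (Fin m) K) R (X p.2)) :=
    fun p => gradedAeval_X _ _ _ p
  have hfg : ∀ x, f (g x) = x := by
    have : f.toAlgHom.comp g.toAlgHom = AlgHom.id R _ := by
      apply MvPolynomial.algHom_ext
      intro p
      change f (g (X p)) = X p
      rw [hg, hf]
    exact AlgHom.congr_fun this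
  have hgf : ∀ x, g (f x) = x := by
    refine gradedAlgHom_eq_id _ f g (MvPolynomial.adjoin_range_X (R := K) (σ := Fin m)) ?_
    rintro _ ⟨j, rfl⟩ k
    rw [hf, hg]
  refine ⟨AlgEquiv.ofAlgHom (map g) (map f) (map_comp_map_eq_id f g hgf)
    (map_comp_map_eq_id g f hfg), ⟨g, rfl⟩, ⟨f, rfl⟩, fun i j => ?_⟩
  change map g (of _ (X (i, j))) = _
  rw [GradedCompletion.map_of, hg]

end HigherDifferentials

/-! ### Local rings whose maximal ideal has few generators -/

namespace IsLocalRing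

variable {S : Type*} [CommRing S] [IsLocalRing S]

/-- An element of `𝔪 \ 𝔪²` can replace one of the generators of `𝔪`. -/
theorem exists_maximalIdeal_quotient_eq_span {n : ℕ} (t : Fin (n + 1) → S)
    (ht : Ideal.span (Set.range t) = maximalIdeal S) {x : S} (hx : x ∈ maximalIdeal S)
    (hx2 : x ∉ maximalIdeal S ^ 2) :
    ∃ i, (maximalIdeal S).map (Ideal.Quotient.mk (Ideal.span {x})) =
      Ideal.span (Set.range fun j => Ideal.Quotient.mk (Ideal.span {x}) (t (Fin.succAbove i j))) := by
  have hmem : ∀ i, t i ∈ maximalIdeal S := fun i => ht ▸ Ideal.subset_span ⟨i, rfl⟩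
  obtain ⟨c, hc⟩ := Ideal.mem_span_range_iff_exists_fun.1 (ht.symm ▸ hx)
  obtain ⟨i, hi⟩ : ∃ i, IsUnit (c i) := by
    -- If every coefficient were in `𝔪`, then `x = ∑ c i * t i` would lie in `𝔪²`.
    by_contra! h
    refine hx2 (hc ▸ Ideal.sum_mem _ fun i _ => ?_)
    rw [pow_two]
    exact Ideal.mul_mem_mul ((mem_maximalIdeal _).2 (h i)) (hmem i)
  refine ⟨i, le_antisymm ?_ ?_⟩
  · rw [← ht, Ideal.map_span, Ideal.span_le]
    rintro _ ⟨_, ⟨j, rfl⟩, rfl⟩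
    have hj : ∀ j, Ideal.Quotient.mk (Ideal.span {x}) (t (i.succAbove j)) ∈
        Ideal.span (Set.range fun j => Ideal.Quotient.mk (Ideal.span {x}) (t (i.succAbove j))) :=
      fun j => Ideal.subset_span ⟨j, rfl⟩
    rcases Fin.eq_self_or_eq_succAbove i j with rfl | ⟨j, rfl⟩
    -- Modulo `x` this relation has a unit coefficient at the omitted generator, hence expresses it
    -- through the others.
    · have h0 : Ideal.Quotient.mk (Ideal.span {x}) (∑ i, c i * t i) = 0 := by
        rw [Ideal.Quotient.eq_zero_iff_mem, hc]
        exact Ideal.mem_span_singleton_self _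
      rw [Fin.sum_univ_succAbove _ j, map_add, map_mul, map_sum, add_eq_zero_iff_eq_neg] at h0
      rw [SetLike.mem_coe, ← Ideal.unit_mul_mem_iff_mem _ (hi.map (Ideal.Quotient.mk _)), h0]
      refine neg_mem (Ideal.sum_mem _ fun k _ => ?_)
      rw [map_mul]
      exact Ideal.mul_mem_left _ _ (hj k)
    · exact hj j
  · rw [Ideal.span_le]
    rintro _ ⟨j, rfl⟩
    exact Ideal.mem_map_of_mem _ (hmem _)

/-- A Noetherian local ring of positive dimension has an element of `𝔪 \ 𝔪²` that lies in no
minimal prime. -/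
theorem exists_mem_maximalIdeal_notMem_sq [IsNoetherianRing S] (h : ringKrullDim S ≠ 0) :
    ∃ x ∈ maximalIdeal S, x ∉ maximalIdeal S ^ 2 ∧ ∀ p ∈ minimalPrimes S, x ∉ p := by
  by_contra! hcon
  have hmin : maximalIdeal S ∉ minimalPrimes S := by
    intro hm
    apply h
    rw [← maximalIdeal_height_eq_ringKrullDim, Ideal.height_eq_zero_iff.2 hm]
    rfl
  have hsub : (maximalIdeal S : Set S) ⊆
      ⋃ I ∈ insert (maximalIdeal S ^ 2) (minimalPrimes S), (I : Set S) := by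
    intro x hx
    by_cases hx2 : x ∈ maximalIdeal S ^ 2
    · exact Set.mem_biUnion (Set.mem_insert _ _) hx2
    · obtain ⟨p, hp, hxp⟩ := hcon x hx hx2
      exact Set.mem_biUnion (Set.mem_insert_of_mem _ hp) hxp
  -- Prime avoidance tolerates two non-prime members; both slots are filled with `𝔪²`. Then either
  -- `𝔪 ≤ 𝔪²`, so `𝔪 = 0` by Nakayama, or `𝔪` is a minimal prime; both force dimension zero.
  obtain ⟨I, rfl | hI, hle⟩ := (Ideal.subset_union_prime_finite (f := id)
    ((minimalPrimes.finite_of_isNoetherianRing S).insert _)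
    (maximalIdeal S ^ 2) (maximalIdeal S ^ 2) (by
      rintro I (rfl | hI) h1 _
      · exact absurd rfl h1
      · exact hI.1.1)).1 hsub
  · have hbot : maximalIdeal S = ⊥ := by
      refine Submodule.eq_bot_of_le_smul_of_le_jacobson_bot (maximalIdeal S) _
        (IsNoetherian.noetherian _) ?_ (maximalIdeal_le_jacobson _)
      rwa [smul_eq_mul, ← pow_two]
    exact h (ringKrullDim_eq_zero_of_isField (isField_iff_maximalIdeal_eq.2 hbot))
  · have := hI.1.1
    exact hmin (le_antisymm hle (le_maximalIdeal this.ne_top) ▸ hI)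

end IsLocalRing

open IsLocalRing

/-- A Noetherian local ring whose maximal ideal is generated by at most `dim` elements is a
domain. -/
theorem IsLocalRing.isDomain_of_le_ringKrullDim {n : ℕ} {S : Type*} [CommRing S] [IsLocalRing S]
    [IsNoetherianRing S] (t : Fin n → S) (ht : Ideal.span (Set.range t) = maximalIdeal S)
    (hn : n ≤ ringKrullDim S) : IsDomain S := by
  induction n generalizing S with
  | zero =>
    rw [Set.range_eq_empty, Ideal.span_empty] at ht
    exact (isField_iff_maximalIdeal_eq.2 ht.symm).isDomain
  | succ n ih =>
    obtain ⟨x, hx, hx2, hxmin⟩ := exists_mem_maximalIdeal_notMem_sq (S := S) (by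
      intro h0
      rw [h0] at hn
      norm_cast at hn)
    obtain ⟨i, hi⟩ := exists_maximalIdeal_quotient_eq_span t ht hx hx2
    have hxtop : Ideal.span {x} ≠ ⊤ := fun h =>
      (mem_maximalIdeal x).1 hx (Ideal.span_singleton_eq_top.1 h)
    have : Nontrivial (S ⧸ Ideal.span {x}) := Ideal.Quotient.nontrivial_iff.2 hxtop
    have : IsLocalRing (S ⧸ Ideal.span {x}) := .of_surjective' _ Ideal.Quotient.mk_surjective
    -- Dividing by `x` removes one generator and lowers the dimension by at most one, so induction
    -- applies to the quotient.
    have hprime : (Ideal.span {x}).IsPrime := by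
      rw [← Ideal.Quotient.isDomain_iff_prime]
      refine ih _ (hi.symm.trans ?_) ?_
      · exact IsLocalRing.map_maximalIdeal_of_surjective _ Ideal.Quotient.mk_surjective
      · have h1 := ringKrullDim_le_ringKrullDim_quotient_add_card {x}
          (by simpa [ringJacobson_eq_maximalIdeal] using hx)
        rw [Finset.card_singleton, Finset.coe_singleton] at h1
        have h2 := hn.trans h1
        rw [Nat.cast_succ, Nat.cast_one] at h2
        exact (WithBot.add_le_add_iff_right' WithBot.one_ne_bot (by decide)).1 h2
    obtain ⟨q, hq, hqx⟩ := Ideal.exists_minimalPrimes_le (I := ⊥) (J := Ideal.span {x}) bot_le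
    have hqprime := hq.1.1
    -- An element of `q` is a multiple `a * x`, and `x ∉ q` puts `a` in `q`. Thus `q = x q`, and
    -- Nakayama gives `q = 0`.
    have hle : q ≤ Ideal.span {x} * q := by
      intro y hy
      obtain ⟨a, rfl⟩ := Ideal.mem_span_singleton'.1 (hqx hy)
      rw [mul_comm a]
      exact Ideal.mul_mem_mul (Ideal.mem_span_singleton_self x)
        ((hqprime.mem_or_mem hy).resolve_right (hxmin q hq))
    have hbot : q = ⊥ := by
      refine Submodule.eq_bot_of_le_smul_of_le_jacobson_bot (Ideal.span {x}) _
        (IsNoetherian.noetherian _) hle ?_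
      exact (le_maximalIdeal hxtop).trans (maximalIdeal_le_jacobson _)
    rw [hbot] at hqprime
    exact IsDomain.of_bot_isPrime S

/-- A surjection of local rings from a Noetherian local ring, whose maximal ideal has `n`
generators, to a ring of dimension `n` is injective. -/
theorem IsLocalRing.injective_of_surjective_of_le_ringKrullDim {n : ℕ} {S R : Type*} [CommRing S]
    [IsLocalRing S] [IsNoetherianRing S] [CommRing R] (t : Fin n → S)
    (ht : Ideal.span (Set.range t) = maximalIdeal S) (f : S →+* R) (hf : Function.Surjective f)
    (hn : n ≤ ringKrullDim R) : Function.Injective f := by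
  have := isDomain_of_le_ringKrullDim t ht (hn.trans (ringKrullDim_le_of_surjective f hf))
  rw [injective_iff_map_eq_zero]
  intro r hr
  by_contra hr0
  -- With `r ≠ 0` in the kernel, `S / r` still surjects onto `R`, so `n + 1 ≤ dim (S / r) + 1 ≤ dim
  -- S ≤ n`.
  have h1 := ringKrullDim_quotient_succ_le_of_nonZeroDivisor (mem_nonZeroDivisors_of_ne_zero hr0)
  have hker : ∀ a ∈ Ideal.span {r}, f a = 0 := by
    intro a ha
    obtain ⟨b, rfl⟩ := Ideal.mem_span_singleton'.1 ha
    rw [map_mul, hr, mul_zero]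
  have h2 : ringKrullDim R ≤ ringKrullDim (S ⧸ Ideal.span {r}) :=
    ringKrullDim_le_of_surjective _ (Ideal.Quotient.lift_surjective_of_surjective _ hker hf)
  have h3 : ringKrullDim S ≤ n := by
    refine (ringKrullDim_le_spanFinrank_maximalIdeal S).trans ?_
    rw [← ht]
    refine Nat.cast_le.2 ((Submodule.spanFinrank_span_le_ncard_of_finite (Set.finite_range t)).trans ?_)
    rw [← Set.image_univ]
    exact (Set.ncard_image_le).trans (by simp [Set.ncard_univ])
  have h4 : ((n : WithBot ℕ∞) + 1) ≤ n := by
    refine le_trans ?_ (h1.trans h3)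
    gcongr
    exact hn.trans h2
  norm_cast at h4
  omega

/-! ### Unramified local algebras -/

open IsLocalRing TensorProduct

namespace Algebra

/-- A local algebra `S` is unramified over `P` if its residue field is, and if its maximal ideal is
generated by elements of `P`. -/
theorem FormallyUnramified.of_span_eq_maximalIdeal {P S : Type*} [CommRing P] [CommRing S]
    [IsLocalRing S] [Algebra P S] [EssFiniteType P S] [FormallyUnramified P (ResidueField S)]
    {s : Set P} (hs : Ideal.span (algebraMap P S '' s) = maximalIdeal S) :
    FormallyUnramified P S := by
  constructor
  -- By Nakayama it suffices that `κ ⊗ Ω[S/P]` vanishes. Since `Ω[κ/P] = 0`, it is the image of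
  -- `𝔪/𝔪²`; the generators come from `P`, so their differentials are zero.
  rw [← subsingleton_tensorProduct (R := S)]
  refine subsingleton_of_forall_eq 0 fun x ↦ ?_
  obtain ⟨x, rfl⟩ := (KaehlerDifferential.exact_kerCotangentToTensor_mapBaseChange P S
    (ResidueField S) Ideal.Quotient.mk_surjective x).mp (Subsingleton.elim _ _)
  obtain ⟨⟨x, hx⟩, rfl⟩ := Ideal.toCotangent_surjective _ x
  simp only [KaehlerDifferential.kerCotangentToTensor_toCotangent]
  replace hx : x ∈ Ideal.span (algebraMap P S '' s) := by simpa [hs] using hx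
  induction hx using Submodule.span_induction with
  | zero => simp
  | mem x h => obtain ⟨x, hx, rfl⟩ := h; simp
  | add x y hx hy _ _ => simp [*, TensorProduct.tmul_add]
  | smul a x hx _ =>
    have : residue S x = 0 := by
      rw [residue_eq_zero_iff, ← hs]
      exact hx
    simp [*, TensorProduct.tmul_add, TensorProduct.smul_tmul', ← Algebra.algebraMap_eq_smul_one]

/-- A maximal ideal below the maximal ideal of an unramified local algebra generates it. -/
theorem FormallyUnramified.map_eq_maximalIdeal {P S : Type*} [CommRing P] [CommRing S]
    [IsLocalRing S] [Algebra P S] [EssFiniteType P S] [FormallyUnramified P S] (p : Ideal P)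
    [p.IsMaximal] (hp : p.map (algebraMap P S) ≤ maximalIdeal S) :
    p.map (algebraMap P S) = maximalIdeal S := by
  -- The fibre `S / pS` is unramified and finite over the field `P / p`, hence reduced, Artinian and
  -- local: a field.
  let : Field (P ⧸ p) := Ideal.Quotient.field p
  have : FormallyUnramified P (S ⧸ p.map (algebraMap P S)) := .comp P S _
  have : FormallyUnramified (P ⧸ p) (S ⧸ p.map (algebraMap P S)) := .of_restrictScalars P _ _
  have : EssFiniteType (P ⧸ p) (S ⧸ p.map (algebraMap P S)) := inferInstance
  have : Module.Finite (P ⧸ p) (S ⧸ p.map (algebraMap P S)) :=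
    FormallyUnramified.finite_of_free _ _
  have : IsReduced (S ⧸ p.map (algebraMap P S)) :=
    FormallyUnramified.isReduced_of_field (P ⧸ p) _
  have : IsArtinianRing (S ⧸ p.map (algebraMap P S)) := isArtinian_of_tower (P ⧸ p) inferInstance
  have : Nontrivial (S ⧸ p.map (algebraMap P S)) :=
    Ideal.Quotient.nontrivial_iff.mpr <| ne_top_of_le_ne_top (maximalIdeal.isMaximal S).ne_top hp
  have : IsLocalRing (S ⧸ p.map (algebraMap P S)) := .of_surjective' _ Ideal.Quotient.mk_surjective
  apply eq_maximalIdeal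
  rw [Ideal.Quotient.maximal_ideal_iff_isField_quotient, isField_iff_maximalIdeal_eq,
    ← jacobson_eq_maximalIdeal _ bot_ne_top, IsArtinianRing.jacobson_eq_radical,
    ← Ideal.zero_eq_bot, ← nilradical, nilradical_eq_zero]

/-- An unramified essentially finite local algebra is a quotient of an étale local algebra. -/
theorem FormallyUnramified.exists_formallyEtale_surjective.{u, v} {P : Type u} (S : Type v) [CommRing P]
    [CommRing S] [IsLocalRing S] [Algebra P S] [EssFiniteType P S] [FormallyUnramified P S] :
    ∃ (E : Type u) (_ : CommRing E) (_ : Algebra P E) (φ : E →ₐ[P] S), IsLocalRing E ∧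
      EssFiniteType P E ∧ FormallyEtale P E ∧ Function.Surjective φ := by
  -- `S` is the localisation at `Q` of the finitely generated subalgebra `A`. Near `Q`, `A` is a
  -- quotient of a standard étale algebra, which is then localised at the preimage of `maximalIdeal
  -- S`.
  let A := EssFiniteType.subalgebra P S
  let Q := (maximalIdeal S).comap (algebraMap A S)
  have hQ : EssFiniteType.submonoid P S = Q.primeCompl := by
    ext a
    change IsUnit (algebraMap A S a) ↔ algebraMap A S a ∉ maximalIdeal S
    simp
  have hloc : IsLocalization.AtPrime S Q := by
    have : IsLocalization (EssFiniteType.submonoid P S) S := inferInstance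
    rwa [hQ] at this
  have : IsUnramifiedAt P Q := FormallyUnramified.of_equiv
    ((IsLocalization.algEquiv Q.primeCompl S (Localization.AtPrime Q)).restrictScalars P)
  obtain ⟨f, hf, E, φ, hφ⟩ := IsUnramifiedAt.exists_hasStandardEtaleSurjectionOn (R := P) Q
  have hfu : ∀ y : Submonoid.powers f, IsUnit (IsScalarTower.toAlgHom P A S y) := by
    rintro ⟨_, n, rfl⟩
    rw [map_pow]
    exact (IsLocalization.map_units S (⟨f, hf⟩ : Q.primeCompl)).pow n
  let χ : E.Ring →ₐ[P] S := (IsLocalization.liftAlgHom hfu).comp φ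
  have hχ : ∀ a : A, ∃ e, χ e = algebraMap A S a := by
    intro a
    obtain ⟨e, he⟩ := hφ (algebraMap A (Localization.Away f) a)
    refine ⟨e, ?_⟩
    change IsLocalization.liftAlgHom hfu (φ e) = _
    rw [he, IsLocalization.coe_liftAlgHom, IsLocalization.lift_eq]
    rfl
  let q := (maximalIdeal S).comap χ
  have hqu : ∀ y : q.primeCompl, IsUnit (χ y) := fun y => by
    by_contra h
    exact y.2 h
  let ψ : Localization.AtPrime q →ₐ[P] S := IsLocalization.liftAlgHom (M := q.primeCompl) hqu
  refine ⟨Localization.AtPrime q, _, _, ψ, inferInstance, inferInstance, inferInstance, fun r => ?_⟩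
  -- Numerator and denominator are lifted separately; the lifted denominator avoids `q` because `s`
  -- becomes a unit in `S`.
  obtain ⟨⟨a, s⟩, hr⟩ := IsLocalization.surj Q.primeCompl r
  obtain ⟨e, he⟩ := hχ a
  obtain ⟨e', he'⟩ := hχ s
  have hu := IsLocalization.map_units S s
  have he'q : e' ∈ q.primeCompl := fun h => (mem_maximalIdeal _).1 h (he' ▸ hu)
  refine ⟨IsLocalization.mk' _ e ⟨e', he'q⟩, ?_⟩
  rw [IsLocalization.coe_liftAlgHom (M := q.primeCompl) hqu, IsLocalization.lift_mk'_spec]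
  change χ e = χ e' * r
  rw [he, he', mul_comm, hr]

end Algebra

/-! ### Étale coordinates in the three cases -/

namespace MvPolynomial

theorem span_range_X_isMaximal (σ K : Type*) [Field K] :
    (Ideal.span (Set.range (X : σ → MvPolynomial σ K))).IsMaximal := by
  have : Ideal.span (Set.range (X : σ → MvPolynomial σ K)) =
      RingHom.ker (constantCoeff : MvPolynomial σ K →+* K) := by
    refine le_antisymm (Ideal.span_le.2 ?_) fun p hp => ?_
    · rintro _ ⟨i, rfl⟩
      exact constantCoeff_X K i
    · rw [← Set.image_univ, mem_ideal_span_X_image]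
      intro c hc
      by_contra! h
      obtain rfl : c = 0 := Finsupp.ext fun i => h i trivial
      exact mem_support_iff.1 hc hp
  rw [this]
  exact RingHom.ker_isMaximal_of_surjective _ fun a => ⟨C a, constantCoeff_C _ a⟩

end MvPolynomial

/-- A regular system of parameters of a regular local ring with separable residue field gives
étale coordinates. -/
theorem IsRegularLocalRing.formallyEtale_mvPolynomial {K R : Type*} [Field K] [CommRing R]
    [IsLocalRing R] {m : ℕ} [Algebra K R] [Algebra (MvPolynomial (Fin m) K) R]
    [IsScalarTower K (MvPolynomial (Fin m) K) R] [Algebra.EssFiniteType K R]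
    [Algebra.IsSeparable K (ResidueField R)] (hdim : m ≤ ringKrullDim R)
    (hspan : Ideal.span (Set.range fun j => algebraMap (MvPolynomial (Fin m) K) R (X j)) =
      maximalIdeal R) :
    Algebra.FormallyEtale (MvPolynomial (Fin m) K) R := by
  set P := MvPolynomial (Fin m) K
  have : Algebra.EssFiniteType P R := .of_comp K P R
  have : Algebra.FormallyUnramified K (ResidueField R) := .of_isSeparable _ _
  have : Algebra.FormallyUnramified P (ResidueField R) := .of_restrictScalars K P _
  have : Algebra.FormallyUnramified P R := .of_span_eq_maximalIdeal (s := Set.range X) (by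
    rwa [← Set.range_comp])
  obtain ⟨E, _, _, φ, _, _, _, hφ⟩ :=
    Algebra.FormallyUnramified.exists_formallyEtale_surjective (P := P) R
  have : IsNoetherianRing E := Algebra.EssFiniteType.isNoetherianRing P E
  have := MvPolynomial.span_range_X_isMaximal (Fin m) K
  -- The surjection `φ` is local, so the maximal ideal `(X_1, …, X_m)` of `P` maps into
  -- `maximalIdeal E`; as `E` is unramified over `P`, it generates it.
  have hE : Ideal.span (Set.range fun j => algebraMap P E (X j)) = maximalIdeal E := by
    have hle : (Ideal.span (Set.range (X : Fin m → P))).map (algebraMap P E) ≤ maximalIdeal E := by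
      have := IsLocalHom.of_surjective (φ : E →+* R) hφ
      rw [Ideal.map_span, Ideal.span_le]
      rintro _ ⟨_, ⟨j, rfl⟩, rfl⟩ h
      have h1 : algebraMap P R (X j) ∈ maximalIdeal R := hspan ▸ Ideal.subset_span ⟨j, rfl⟩
      refine (mem_maximalIdeal _).1 h1 ?_
      rw [← φ.commutes]
      exact h.map φ
    rw [← Algebra.FormallyUnramified.map_eq_maximalIdeal _ hle, Ideal.map_span, ← Set.range_comp]
    rfl
  have hinj : Function.Injective φ :=
    injective_of_surjective_of_le_ringKrullDim _ hE (φ : E →+* R) hφ hdim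
  exact .of_equiv (AlgEquiv.ofBijective φ ⟨hinj, hφ⟩)

open scoped IntermediateField.algebraAdjoinAdjoin in
/-- A separating transcendence basis gives étale coordinates. -/
theorem AlgebraicIndependent.formallyEtale_aeval {ι K F : Type*} [Field K] [Field F] [Algebra K F]
    {t : ι → F} (ht : AlgebraicIndependent K t)
    [Algebra.IsSeparable (IntermediateField.adjoin K (Set.range t)) F] :
    (aeval t : MvPolynomial ι K →ₐ[K] F).toRingHom.FormallyEtale := by
  have h1 : ht.aevalEquiv.toAlgHom.toRingHom.FormallyEtale := by
    algebraize [ht.aevalEquiv.toAlgHom.toRingHom]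
    exact .of_equiv { ht.aevalEquiv with commutes' := fun _ => rfl }
  have h2 : (algebraMap (Algebra.adjoin K (Set.range t))
      (IntermediateField.adjoin K (Set.range t))).FormallyEtale :=
    RingHom.formallyEtale_algebraMap.2
      (Algebra.FormallyEtale.of_isLocalization (nonZeroDivisors _))
  have h3 : (algebraMap (IntermediateField.adjoin K (Set.range t)) F).FormallyEtale :=
    RingHom.formallyEtale_algebraMap.2 (Algebra.FormallyEtale.of_isSeparable _ _)
  exact (h1.comp h2).comp h3

theorem HigherDifferentials.isCompletedPolynomialAlgebra_of_formallyEtale_aeval {K R : Type*}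
    [CommRing K] [CommRing R] [Algebra K R] {m : ℕ} (t : Fin m → R)
    (h : (aeval t : MvPolynomial (Fin m) K →ₐ[K] R).toRingHom.FormallyEtale) :
    IsCompletedPolynomialAlgebra K t := by
  algebraize [(aeval t : MvPolynomial (Fin m) K →ₐ[K] R).toRingHom]
  have : IsScalarTower K (MvPolynomial (Fin m) K) R :=
    .of_algebraMap_eq fun a => ((aeval t : MvPolynomial (Fin m) K →ₐ[K] R).commutes a).symm
  have ht : (fun j => algebraMap (MvPolynomial (Fin m) K) R (X j)) = t :=
    funext fun j => aeval_X t j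
  rw [← ht]
  exact isCompletedPolynomialAlgebra_of_formallyEtale K

theorem theorem3p10 {K : Type*} [Field K] [PerfectField K] (m : ℕ) :
    -- (a) polynomial rings
    HigherDifferentials.IsCompletedPolynomialAlgebra K
      (fun j : Fin m => (MvPolynomial.X j : MvPolynomial (Fin m) K)) ∧
    -- (b) finite separable extensions of rational function fields
    (∀ {F : Type*} [Field F] [Algebra K F] (t : Fin m → F), AlgebraicIndependent K t →
      FiniteDimensional (IntermediateField.adjoin K (Set.range t)) F →
      Algebra.IsSeparable (IntermediateField.adjoin K (Set.range t)) F →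
      HigherDifferentials.IsCompletedPolynomialAlgebra K t) ∧
    -- (c) regular local rings
    (∀ {R : Type*} [CommRing R] [Algebra K R] [IsRegularLocalRing R] (t : Fin m → R),
      ringKrullDim R = m →
      Ideal.span (Set.range t) = IsLocalRing.maximalIdeal R →
      Algebra.EssFiniteType K R →
      FiniteDimensional K (IsLocalRing.ResidueField R) →
      Algebra.IsSeparable K (IsLocalRing.ResidueField R) →
      HigherDifferentials.IsCompletedPolynomialAlgebra K t) := by
  refine ⟨?_, ?_, ?_⟩
  -- The polynomial ring is étale over itself, with the variables as coordinates.
  · have h := HigherDifferentials.isCompletedPolynomialAlgebra_of_formallyEtale (m := m) K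
      (R := MvPolynomial (Fin m) K)
    simpa only [Algebra.algebraMap_self, RingHom.id_apply] using h
  · intro F _ _ t ht _ _
    exact HigherDifferentials.isCompletedPolynomialAlgebra_of_formallyEtale_aeval t
      ht.formallyEtale_aeval
  · intro R _ _ _ t hdim hspan _ _ _
    apply HigherDifferentials.isCompletedPolynomialAlgebra_of_formallyEtale_aeval
    algebraize [(aeval t : MvPolynomial (Fin m) K →ₐ[K] R).toRingHom]
    have : IsScalarTower K (MvPolynomial (Fin m) K) R :=
      .of_algebraMap_eq fun a => ((aeval t : MvPolynomial (Fin m) K →ₐ[K] R).commutes a).symm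
    have ht : (fun j => algebraMap (MvPolynomial (Fin m) K) R (X j)) = t :=
      funext fun j => aeval_X t j
    exact IsRegularLocalRing.formallyEtale_mvPolynomial hdim.ge (by rw [ht, hspan])
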